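/- **Conventions.** Let $m,r\in\mathbb N$ and let $\sigma:\mathbb R\to\mathbb R$ be a Lipschitz continuous function that is not affine (the activation). Neural networks are fully connected feedforward networks with activation $\sigma$ (applied componentwise), of arbitrary depth and widths and with affine output layer; a single affine map is also a network. For a bounded measurable $\Omega\subset\mathbb R^n$, a *neural operator* $\Psi_0:L^1(\Omega)\to L^1(\Omega)$ is a map $\Psi_0=\mathcal Q\circ\mathcal L_L\circ\dots\circ\mathcal L_1\circ\mathcal R$ with $L\ge 1$, where $\mathcal R(f)(x)=R(x,f(x))$ and $\mathcal Q(f)(x)=Q(x,f(x))$ for neural networks $R:\mathbb R^{n+1}\to\mathbb R^{d_0}$ and $Q:\mathbb R^{n+d_L}\to\mathbb R$, and $$\mathcal L_\ell(f)(x)=\sigma\Big(W_\ell f(x)+b_\ell+\sum_{k=1}^{M_\ell}\langle T_{\ell,k}f,\psi_{\ell,k}\rangle_{L^2(\Omega;\mathbb R^{d_{\ell-1}})}\,\varphi_{\ell,k}(x)\Big)$$ with $W_\ell\in\mathbb R^{d_\ell\times d_{\ell-1}}$, $b_\ell\in\mathbb R^{d_\ell}$, $T_{\ell,k}\in\mathbb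 R^{d_{\ell-1}\times d_{\ell-1}}$, $\psi_{\ell,k}\in L^1\cap L^\infty(\Omega;\mathbb R^{d_{\ell-1}})$, $\varphi_{\ell,k}\in L^1(\Omega;\mathbb R^{d_\ell})$. A *full space neural operator* with truncation set $\Omega$ (on both the input and the output side) is a map $\Psi=\mathcal Z_\Omega\circ\Psi_0\circ S\circ\mathcal R_\Omega:L^1(\mathbb R^n)\to L^1(\mathbb R^n)$, where $\mathcal R_\Omega f=f|_\Omega$, $S$ is a one-hidden-layer ReLU network $\mathbb R\to\mathbb R$ acting pointwise, $\Psi_0:L^1(\Omega)\to L^1(\Omega)$ is a neural operator, and $\mathcal Z_\Omega$ is extension by zero. For a probability density $f\in L^1(\mathbb R^m\times\mathbb R^r)$ let $m_f(y)=\int_{\mathbb R^m}f(x,y)\,dx$. For $\delta>0$ and $B\subset\mathbb R^r$ bounded and open, let $\mathcal U_{\delta,B}$ be the set of probability densities $f\in L^1(\mathbb R^m\times\mathbb R^r)$ with $\operatorname{ess\,inf}_{y\in B}m_f(y)\ge\delta$, and let $\mathcal G^\star:\mathcal U_{\delta,B}\to L^1(\mathbb R^m\times B)$, $\mathcal G^\star(f)(x,y)=f(x,y)/m_f(y)$,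 be the kernel conditioning operator. **Corollary (Approximation of $\mathcal G^\star$ on whole space).** Let $\varepsilon>0$, $\delta>0$, let $B\subset\mathbb R^r$ be bounded and open, and let $K\subset\mathcal U_{\delta,B}$ be compact in $L^1(\mathbb R^m\times\mathbb R^r)$. Then there exist $R>0$ and a full space neural operator $\Psi:L^1(\mathbb R^{m+r})\to L^1(\mathbb R^{m+r})$ with activation $\sigma$ and truncation set $\Omega=(-R,R)^{m+r}$ such that $$\sup_{\rho\in K}\|\mathcal G^\star(\rho)-\Psi(\rho)\|_{L^1(\mathbb R^m\times B)}\le\varepsilon .$$ -/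

import Mathlib

open MeasureTheory
open scoped ENNReal Matrix

namespace FullSpaceConditioning

/-! ### `L¹` spaces, restriction and zero extension -/

/-- `L¹(ℝⁿ)` with respect to Lebesgue measure. -/
abbrev L1 (n : ℕ) : Type := Lp ℝ 1 (volume : Measure (Fin n → ℝ))

/-- `L¹(Ω)` with respect to Lebesgue measure, for `Ω ⊆ ℝⁿ`. -/
abbrev L1On {n : ℕ} (Ω : Set (Fin n → ℝ)) : Type :=
  Lp ℝ 1 ((volume : Measure (Fin n → ℝ)).restrict Ω)

/-- The restriction operator `L¹(ℝⁿ) → L¹(Ω)`, `f ↦ f|_Ω`. -/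
noncomputable def restriction {n : ℕ} (Ω : Set (Fin n → ℝ)) (f : L1 n) : L1On Ω :=
  ((Lp.memLp f).restrict Ω).toLp f

/-- The zero extension operator `L¹(Ω) → L¹(ℝⁿ)`. -/
noncomputable def zeroExtension {n : ℕ} {Ω : Set (Fin n → ℝ)} (hΩ : MeasurableSet Ω)
    (f : L1On Ω) : L1 n :=
  ((memLp_indicator_iff_restrict hΩ).2 (Lp.memLp f)).toLp (Ω.indicator f)

/-- The open cube `(-R, R)ⁿ`. -/
def cube (n : ℕ) (R : ℝ) : Set (Fin n → ℝ) := Set.univ.pi fun _ => Set.Ioo (-R) R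

theorem measurableSet_cube (n : ℕ) (R : ℝ) : MeasurableSet (cube n R) :=
  MeasurableSet.univ_pi fun _ => measurableSet_Ioo

/-! ### Neural networks -/

/-- The parameters of a fully connected feedforward network `ℝᵃ → ℝᵇ` of arbitrary depth and
widths: either a single affine map, or an affine map followed by the activation and
a further network. -/
inductive NeuralNet : ℕ → ℕ → Type
  | affine {a b : ℕ} (A : Matrix (Fin b) (Fin a) ℝ) (v : Fin b → ℝ) : NeuralNet a b
  | layer {a b c : ℕ} (A : Matrix (Fin b) (Fin a) ℝ) (v : Fin b → ℝ) (N : NeuralNet b c) :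
      NeuralNet a c

/-- The function realized by a network with activation `σ` (applied componentwise). -/
def NeuralNet.eval (σ : ℝ → ℝ) : {a b : ℕ} → NeuralNet a b → (Fin a → ℝ) → (Fin b → ℝ)
  | _, _, .affine A v => fun x => A *ᵥ x + v
  | _, _, .layer A v N => fun x => N.eval σ fun i => σ ((A *ᵥ x + v) i)

/-- `S : ℝ → ℝ` is a shallow (one hidden layer) ReLU network. -/
def IsShallowReLU (S : ℝ → ℝ) : Prop :=
  ∃ (N : ℕ) (α w b : Fin N → ℝ) (c : ℝ), ∀ z, S z = ∑ i, α i * max (w i * z + b i) 0 + c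

/-! ### Neural operators on a domain `Ω ⊆ ℝⁿ` -/

/-- The parameters of a hidden layer mapping functions `Ω → ℝᵃ` to functions `Ω → ℝᵇ`.
The encoding functions `ψ k` lie in `L¹ ∩ L^∞`, so that they can be paired with `L¹` functions;
the decoding functions `φ k` lie in `L¹`. -/
structure HiddenLayer {n : ℕ} (Ω : Set (Fin n → ℝ)) (a b : ℕ) where
  W : Matrix (Fin b) (Fin a) ℝ
  bias : Fin b → ℝ
  M : ℕ
  T : Fin M → Matrix (Fin a) (Fin a) ℝ
  ψ : Fin M → (Fin n → ℝ) → (Fin a → ℝ)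
  φ : Fin M → (Fin n → ℝ) → (Fin b → ℝ)
  ψ_memLp_one : ∀ k, MemLp (ψ k) 1 (volume.restrict Ω)
  ψ_memLp_top : ∀ k, MemLp (ψ k) ∞ (volume.restrict Ω)
  φ_memLp_one : ∀ k, MemLp (φ k) 1 (volume.restrict Ω)

/-- `f ↦ σ (W f(x) + bias + ∑ₖ ⟨Tₖ f, ψₖ⟩ φₖ(x))`, with `⟨·,·⟩` the `L²(Ω; ℝᵃ)` pairing. -/
noncomputable def HiddenLayer.eval {n : ℕ} {Ω : Set (Fin n → ℝ)} {a b : ℕ} (σ : ℝ → ℝ)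
    (l : HiddenLayer Ω a b) (f : (Fin n → ℝ) → (Fin a → ℝ)) : (Fin n → ℝ) → (Fin b → ℝ) :=
  fun x i => σ ((l.W *ᵥ f x + l.bias +
    ∑ k, (∫ z in Ω, (l.T k *ᵥ f z) ⬝ᵥ l.ψ k z) • l.φ k x) i)

/-- A nonempty finite sequence of composable hidden layers. -/
inductive HiddenStack {n : ℕ} (Ω : Set (Fin n → ℝ)) : ℕ → ℕ → Type
  | single {a b : ℕ} (l : HiddenLayer Ω a b) : HiddenStack Ω a b
  | cons {a b c : ℕ} (l : HiddenLayer Ω a b) (s : HiddenStack Ω b c) : HiddenStack Ω a c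

/-- The composition of the layers, the first one being applied first. -/
noncomputable def HiddenStack.eval {n : ℕ} {Ω : Set (Fin n → ℝ)} (σ : ℝ → ℝ) :
    {a b : ℕ} → HiddenStack Ω a b →
      ((Fin n → ℝ) → (Fin a → ℝ)) → ((Fin n → ℝ) → (Fin b → ℝ))
  | _, _, .single l => l.eval σ
  | _, _, .cons l s => fun f => s.eval σ (l.eval σ f)

/-- The parameters of a neural operator of positive depth on `Ω`, mapping functions `Ω → ℝᵃ` to
functions `Ω → ℝᵇ`: lifting network, hidden layers, projection network. -/
structure NeuralOperator {n : ℕ} (Ω : Set (Fin n → ℝ)) (a b : ℕ) where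
  dFirst : ℕ
  dLast : ℕ
  lift : NeuralNet (n + a) dFirst
  hidden : HiddenStack Ω dFirst dLast
  proj : NeuralNet (n + dLast) b

/-- `f ↦ (Q ∘ L_L ∘ ⋯ ∘ L_1 ∘ R)(f)` with `R(f)(x) = R(x, f(x))` and `Q(f)(x) = Q(x, f(x))`. -/
noncomputable def NeuralOperator.eval {n : ℕ} {Ω : Set (Fin n → ℝ)} {a b : ℕ} (σ : ℝ → ℝ)
    (N : NeuralOperator Ω a b) (f : (Fin n → ℝ) → (Fin a → ℝ)) : (Fin n → ℝ) → (Fin b → ℝ) :=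
  fun x => N.proj.eval σ
    (Fin.append x (N.hidden.eval σ (fun z => N.lift.eval σ (Fin.append z (f z))) x))

/-- `Ψ₀ : L¹(Ω) → L¹(Ω)` is (given by) a neural operator with activation `σ`. -/
def IsNeuralOperator (σ : ℝ → ℝ) {n : ℕ} (Ω : Set (Fin n → ℝ)) (Ψ₀ : L1On Ω → L1On Ω) : Prop :=
  ∃ N : NeuralOperator Ω 1 1, ∀ f : L1On Ω,
    Ψ₀ f =ᵐ[volume.restrict Ω] fun x => N.eval σ (fun z _ => f z) x 0

/-- `Ψ : L¹(ℝⁿ) → L¹(ℝⁿ)` is a full space neural operator with activation `σ` and truncation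
sets `Ω' = Ω` (a bounded measurable set): `Ψ = Z_Ω ∘ Ψ₀ ∘ S ∘ R_Ω`, where `R_Ω` is restriction,
`S` a shallow ReLU network acting pointwise, `Ψ₀` a neural operator on `L¹(Ω)`, and `Z_Ω` zero
extension. -/
def IsFullNO (σ : ℝ → ℝ) {n : ℕ} {Ω : Set (Fin n → ℝ)} (hΩ : MeasurableSet Ω)
    (Ψ : L1 n → L1 n) : Prop :=
  ∃ (S : ℝ → ℝ) (SΩ : L1On Ω → L1On Ω) (Ψ₀ : L1On Ω → L1On Ω),
    IsShallowReLU S ∧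
    (∀ f : L1On Ω, SΩ f =ᵐ[volume.restrict Ω] fun x => S (f x)) ∧
    IsNeuralOperator σ Ω Ψ₀ ∧
    ∀ f : L1 n, Ψ f = zeroExtension hΩ (Ψ₀ (SΩ (restriction Ω f)))

/-! ### Conditioning on `ℝ^{m+r} = ℝᵐ × ℝʳ`, the point `(x, y)` being `Fin.append x y` -/

/-- The second component `y ∈ ℝʳ` of `z = (x, y) ∈ ℝ^{m+r}`. -/
def query {m r : ℕ} (z : Fin (m + r) → ℝ) : Fin r → ℝ := fun j => z (Fin.natAdd m j)

/-- The set `ℝᵐ × B ⊆ ℝ^{m+r}`. -/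
def strip (m : ℕ) {r : ℕ} (B : Set (Fin r → ℝ)) : Set (Fin (m + r) → ℝ) := {z | query z ∈ B}

/-- The marginal `m_f(y) = ∫ f(x, y) dx`. -/
noncomputable def marginal {m r : ℕ} (f : L1 (m + r)) (y : Fin r → ℝ) : ℝ :=
  ∫ x : Fin m → ℝ, f (Fin.append x y)

/-- The probability densities in `L¹(ℝⁿ)`. -/
def densities (n : ℕ) : Set (L1 n) := {f | (∀ᵐ z, 0 ≤ f z) ∧ ∫ z, f z = 1}

/-- `𝒰_{δ,B}`: the densities on `ℝᵐ × ℝʳ` with `ess inf_{y ∈ B} m_f(y) ≥ δ`. -/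
def densitiesBoundedBelow (m : ℕ) {r : ℕ} (δ : ℝ) (B : Set (Fin r → ℝ)) : Set (L1 (m + r)) :=
  {f | f ∈ densities (m + r) ∧
    (δ : EReal) ≤ essInf (fun y => ((marginal f y : ℝ) : EReal)) (volume.restrict B)}

/-- The conditional density `κ_f(x, y) = f(x, y) / m_f(y)`, as a function of `z = (x, y)`. -/
noncomputable def kernelFun {m r : ℕ} (f : L1 (m + r)) (z : Fin (m + r) → ℝ) : ℝ :=
  f z / marginal f (query z)

theorem measurable_append {m r : ℕ} :
    Measurable fun p : (Fin m → ℝ) × (Fin r → ℝ) => Fin.append p.1 p.2 := by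
  refine measurable_pi_iff.2 fun i => ?_
  refine Fin.addCases (fun j => ?_) (fun j => ?_) i
  · simpa [Function.comp_def] using (measurable_pi_apply j).comp measurable_fst
  · simpa [Function.comp_def] using (measurable_pi_apply j).comp measurable_snd

theorem measurable_query {m r : ℕ} : Measurable (query : (Fin (m + r) → ℝ) → Fin r → ℝ) :=
  measurable_pi_iff.2 fun j => measurable_pi_apply (Fin.natAdd m j)

theorem measurable_marginal {m r : ℕ} (f : L1 (m + r)) : Measurable (marginal f) := by
  have h : StronglyMeasurable fun p : (Fin r → ℝ) × (Fin m → ℝ) => f (Fin.append p.2 p.1) :=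
    (Lp.stronglyMeasurable f).comp_measurable (measurable_append.comp measurable_swap)
  exact h.integral_prod_right'.measurable

theorem quasiMeasurePreserving_query {m r : ℕ} :
    Measure.QuasiMeasurePreserving (query : (Fin (m + r) → ℝ) → Fin r → ℝ) volume volume := by
  have h1 := (volume_measurePreserving_piCongrLeft (fun _ : Fin (m + r) => ℝ)
    (finSumFinEquiv (m := m) (n := r))).symm
  have h2 := volume_measurePreserving_sumPiEquivProdPi (fun _ : Fin m ⊕ Fin r => ℝ)
  have h3 := (Measure.quasiMeasurePreserving_snd (μ := (volume : Measure (Fin m → ℝ)))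
    (ν := (volume : Measure (Fin r → ℝ)))).comp
      (h2.quasiMeasurePreserving.comp h1.quasiMeasurePreserving)
  exact h3

theorem memLp_kernelFun {m r : ℕ} {δ : ℝ} (hδ : 0 < δ) {B : Set (Fin r → ℝ)}
    (hB : MeasurableSet B) {f : L1 (m + r)} (hf : f ∈ densitiesBoundedBelow m δ B) :
    MemLp (kernelFun f) 1 (volume.restrict (strip m B)) := by
  have hlow : ∀ᵐ y ∂(volume.restrict B), δ ≤ marginal f y := by
    filter_upwards [ae_essInf_le (f := fun y => ((marginal f y : ℝ) : EReal))
      (μ := volume.restrict B)] with y hy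
    exact EReal.coe_le_coe_iff.1 (hf.2.trans hy)
  rw [ae_restrict_iff' hB] at hlow
  have hlow2 : ∀ᵐ z ∂(volume.restrict (strip m B)), δ ≤ marginal f (query z) := by
    have hstrip : MeasurableSet (strip m B) := measurable_query hB
    rw [ae_restrict_iff' hstrip]
    exact quasiMeasurePreserving_query.ae hlow
  have hmeas : AEStronglyMeasurable (kernelFun f) (volume.restrict (strip m B)) :=
    ((Lp.stronglyMeasurable f).measurable.div
      ((measurable_marginal f).comp measurable_query)).aestronglyMeasurable
  refine MemLp.of_le_mul (c := δ⁻¹) ((Lp.memLp f).restrict (strip m B)) hmeas ?_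
  filter_upwards [hlow2] with z hz
  have hpos : 0 < marginal f (query z) := hδ.trans_le hz
  rw [kernelFun, norm_div, Real.norm_of_nonneg hpos.le, div_eq_inv_mul]
  exact mul_le_mul_of_nonneg_right (inv_anti₀ hδ hz) (norm_nonneg _)

/-- The kernel conditioning operator `𝒢⋆ : 𝒰_{δ,B} → L¹(ℝᵐ × B)`, `f ↦ κ_f`. -/
noncomputable def kernelConditioning {m r : ℕ} {δ : ℝ} (hδ : 0 < δ) {B : Set (Fin r → ℝ)}
    (hB : MeasurableSet B) (f : densitiesBoundedBelow m δ B) : L1On (strip m B) :=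
  (memLp_kernelFun hδ hB f.2).toLp (kernelFun (f : L1 (m + r)))

end FullSpaceConditioning

namespace FullSpaceConditioning

/-! ### Functions with vanishing second differences, smoothing of the activation -/

/-! Conditioning is Lipschitz in L¹ with constant `2 / δ` (`lipschitzWith_kernelConditioning`), so
the theorem is an instance of universal approximation for a continuous map `G` from a compact `K ⊆
L1 n` to `L1On T` (`exists_isFullNO_approx`).

By compactness, the inputs are nearly determined by their restrictions to one large cube `Ω`. Hence
`G` is uniformly close to `∑ j, c j • φ j`, with fixed continuous `φ j` supported in `Ω` and weights
`c j` forming a partition of unity in the restricted input (`exists_finite_rank_approx`). This sum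
is one continuous function `H (u, x)` on the compact product of the restricted inputs and the closed
cube, and it suffices to approximate it uniformly.

A single hidden layer realizes linear combinations of neurons `σ (w · x + b + ∫ u ψ)`. The
pre-activations form a vector space that contains the constants and separates points, and for
Lipschitz non-affine `σ` the neurons then have dense span (`neuronSpan_eq_top`). Indeed some
mollification `g` of `σ` is smooth and non-affine; being Lipschitz, it is not a polynomial.
Differentiating `g (a L + b)` in `a` at `0` puts every power `L ^ k` in the closed span, hence also
`exp L`. The exponentials are closed under products and separate points, so Stone–Weierstrass
applies. -/

theorem affine_of_second_difference_eq_zero {σ : ℝ → ℝ} (hσ : Continuous σ)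
    (h : ∀ x y z, σ (x + y + z) - σ (x + y) - σ (x + z) + σ x = 0) :
    ∃ a b : ℝ, ∀ x, σ x = a * x + b := by
  -- The hypothesis at base point `0` says that `σ - σ 0` is additive; continuity makes it
  -- `ℝ`-linear.
  let L : ℝ →+ ℝ :=
    { toFun := fun x => σ x - σ 0
      map_zero' := sub_self _
      map_add' := fun x y => by
        have := h 0 x y
        simp only [zero_add] at this
        linarith }
  have hL : Continuous L := hσ.sub continuous_const
  refine ⟨L 1, σ 0, fun x => ?_⟩
  have h1 : L.toRealLinearMap hL (x • (1 : ℝ)) = x • L.toRealLinearMap hL 1 := map_smul _ _ _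
  have h2 : L x = x * L 1 := by simpa using h1
  have h3 : L x = σ x - σ 0 := rfl
  linarith

/-- A bounded polynomial is constant. The induction runs on increments: if the `(k+1)`-st derivative
vanishes, the `k`-th one is constant, so each `h (· + s) - h` is bounded with zero `k`-th
derivative. -/
theorem eq_of_iteratedDeriv_eq_zero_of_bounded (k : ℕ) :
    ∀ {h : ℝ → ℝ}, ContDiff ℝ (⊤ : ℕ∞) h → (∃ C, ∀ x, |h x| ≤ C) →
      (∀ x, iteratedDeriv k h x = 0) → ∀ x y, h x = h y := by
  induction k with
  | zero => intro h _ _ h0 x y; simpa using (h0 x).trans (h0 y).symm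
  | succ k ih =>
    intro h hh hb h0 x y
    obtain ⟨C, hC⟩ := hb
    have hd : Differentiable ℝ (iteratedDeriv k h) :=
      hh.differentiable_iteratedDeriv k (by exact_mod_cast WithTop.coe_lt_top _)
    have hconst : ∀ x y, iteratedDeriv k h x = iteratedDeriv k h y :=
      is_const_of_deriv_eq_zero hd fun x => by rw [← iteratedDeriv_succ]; exact h0 x
    have hs : ∀ s : ℝ, ContDiff ℝ (⊤ : ℕ∞) fun x => h (x + s) := fun s =>
      hh.comp (contDiff_id.add contDiff_const)
    have key : ∀ s x y : ℝ, h (x + s) - h x = h (y + s) - h y := fun s => by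
      refine ih (h := fun x => h (x + s) - h x) ((hs s).sub hh) ⟨C + C, fun x => ?_⟩ fun x => ?_
      · exact (abs_sub _ _).trans (add_le_add (hC _) (hC _))
      · have := iteratedDeriv_fun_sub (n := k) (x := x)
          ((hs s).contDiffAt.of_le (by exact_mod_cast le_top))
          (hh.contDiffAt.of_le (by exact_mod_cast le_top))
        rw [this, iteratedDeriv_comp_add_const]
        exact sub_eq_zero.2 (hconst _ _)
    -- Constant increments make `h` affine along arithmetic progressions, which boundedness allows
    -- only for zero slope.
    have hn : ∀ n : ℕ, h (x + n * (y - x)) = h x + n * (h y - h x) := fun n => by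
      induction n with
      | zero => simp
      | succ n ihn =>
        have := key (y - x) (x + n * (y - x)) x
        rw [ihn, add_sub_cancel] at this
        rw [show x + ((n + 1 : ℕ) : ℝ) * (y - x) = x + n * (y - x) + (y - x) by push_cast; ring]
        push_cast
        linarith
    by_contra hne
    have hpos : 0 < |h y - h x| := abs_pos.2 (sub_ne_zero.2 (Ne.symm hne))
    obtain ⟨n, hnn⟩ := exists_nat_gt ((C + C) / |h y - h x|)
    rw [div_lt_iff₀ hpos] at hnn
    have h1 : |(n : ℝ) * (h y - h x)| ≤ C + C := by
      rw [show (n : ℝ) * (h y - h x) = h (x + n * (y - x)) - h x by rw [hn]; ring]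
      exact (abs_sub _ _).trans (add_le_add (hC _) (hC _))
    rw [abs_mul, Nat.abs_cast] at h1
    linarith

/-- A Lipschitz function has bounded derivative; if that derivative were a polynomial it would be
constant, and `g` affine. -/
theorem exists_iteratedDeriv_ne_zero {g : ℝ → ℝ} (hg : ContDiff ℝ (⊤ : ℕ∞) g) {C : NNReal}
    (hC : LipschitzWith C g) (hna : ¬ ∃ a b : ℝ, ∀ x, g x = a * x + b) (k : ℕ) :
    ∃ b, iteratedDeriv k g b ≠ 0 := by
  by_contra! h0
  have hd : ContDiff ℝ (⊤ : ℕ∞) (deriv g) := (contDiff_infty_iff_deriv.1 hg).2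
  have hdk : ∀ x, iteratedDeriv k (deriv g) x = 0 := fun x => by
    rw [← iteratedDeriv_succ', iteratedDeriv_succ, funext h0]
    simp
  have hc := eq_of_iteratedDeriv_eq_zero_of_bounded k hd
    ⟨C, fun x => norm_deriv_le_of_lipschitz hC⟩ hdk
  have hgd : Differentiable ℝ g := hg.differentiable (by simp)
  refine hna ⟨deriv g 0, g 0, fun x => ?_⟩
  have := is_const_of_deriv_eq_zero (f := fun x => g x - deriv g 0 * x)
    (hgd.sub (differentiable_id.const_mul _)) (fun x => by
      rw [deriv_fun_sub hgd.differentiableAt (by fun_prop)]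
      simp [hc x 0]) x 0
  simp only [mul_zero, sub_zero] at this
  linarith

/-- Affine functions have zero second differences. If mollifications at every scale were affine,
uniform convergence would force the second differences of `σ` to vanish as well. -/
theorem exists_smooth_convolution_not_affine {σ : ℝ → ℝ} {C : NNReal} (hσ : LipschitzWith C σ)
    (hna : ¬ ∃ a b : ℝ, ∀ x, σ x = a * x + b) :
    ∃ η g : ℝ → ℝ, Continuous η ∧ HasCompactSupport η ∧ (∀ x, g x = ∫ t, η t * σ (x - t)) ∧
      ContDiff ℝ (⊤ : ℕ∞) g ∧ LipschitzWith C g ∧ ¬ ∃ a b : ℝ, ∀ x, g x = a * x + b := by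
  by_contra! hcon
  refine hna (affine_of_second_difference_eq_zero hσ.continuous fun x y z => ?_)
  have hsmall : ∀ e : ℝ, 0 < e →
      |σ (x + y + z) - σ (x + y) - σ (x + z) + σ x| ≤ 4 * (C * e) := by
    intro e he
    let φ : ContDiffBump (0 : ℝ) := ⟨e / 2, e, by positivity, by linarith⟩
    let η := φ.normed (volume : Measure ℝ)
    let g : ℝ → ℝ := fun x => ∫ t, η t * σ (x - t)
    have hηc : Continuous η := φ.continuous_normed
    have hηs : HasCompactSupport η := φ.hasCompactSupport_normed
    have hint : ∀ x, Integrable fun t => η t * σ (x - t) := fun x =>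
      Continuous.integrable_of_hasCompactSupport
        (hηc.mul (hσ.continuous.comp (continuous_const.sub continuous_id))) hηs.mul_right
    have hg : ContDiff ℝ (⊤ : ℕ∞) g :=
      hηs.contDiff_convolution_left (ContinuousLinearMap.lsmul ℝ ℝ) φ.contDiff_normed
        hσ.continuous.locallyIntegrable
    have hgl : LipschitzWith C g := by
      refine LipschitzWith.of_dist_le_mul fun a b => ?_
      rw [Real.dist_eq, ← integral_sub (hint a) (hint b)]
      calc |∫ t, (η t * σ (a - t) - η t * σ (b - t))|
          ≤ ∫ t, |η t * σ (a - t) - η t * σ (b - t)| := abs_integral_le_integral_abs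
        _ ≤ ∫ t, η t * (C * dist a b) := by
            refine integral_mono ((hint a).sub (hint b)).abs
              (φ.integrable_normed.mul_const _) fun t => ?_
            rw [← mul_sub, abs_mul, abs_of_nonneg (φ.nonneg_normed t)]
            refine mul_le_mul_of_nonneg_left ?_ (φ.nonneg_normed t)
            simpa [← Real.dist_eq] using hσ.dist_le_mul (a - t) (b - t)
        _ = C * dist a b := by
            rw [integral_mul_const, φ.integral_normed, one_mul]
    obtain ⟨a, b, hab⟩ := hcon η g hηc hηs (fun _ => rfl) hg hgl
    -- The bump is supported within distance `e`, where `σ` varies by at most `C * e`; the second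
    -- difference has four terms.
    have hd : ∀ x, |a * x + b - σ x| ≤ C * e := fun x => by
      rw [← hab]
      refine φ.dist_normed_convolution_le (g := σ) hσ.continuous.aestronglyMeasurable
        fun y hy => (hσ.dist_le_mul y x).trans ?_
      exact mul_le_mul_of_nonneg_left (le_of_lt hy) C.2
    have h1 := abs_le.1 (hd (x + y + z))
    have h2 := abs_le.1 (hd (x + y))
    have h3 := abs_le.1 (hd (x + z))
    have h4 := abs_le.1 (hd x)
    rw [abs_le]
    constructor <;> nlinarith
  by_contra hne
  have hpos := abs_pos.2 hne
  set d := |σ (x + y + z) - σ (x + y) - σ (x + z) + σ x|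
  have := hsmall (d / (8 * (C + 1))) (by positivity)
  have h2 : 4 * ((C : ℝ) * (d / (8 * (C + 1)))) ≤ d / 2 := by
    rw [show 4 * ((C : ℝ) * (d / (8 * (C + 1)))) = (C / (C + 1)) * (d / 2) by field_simp; ring]
    have : (C : ℝ) / (C + 1) ≤ 1 := by
      rw [div_le_one (by positivity)]; linarith
    nlinarith
  linarith

/-! ### Universal approximation on a compact space -/

theorem integral_mem_of_isClosed {X E : Type*} [MeasurableSpace X] (μ : Measure X)
    [NormedAddCommGroup E] [NormedSpace ℝ E] [CompleteSpace E] {V : Submodule ℝ E}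
    (hV : IsClosed (V : Set E)) {f : X → E} (hf : ∀ x, f x ∈ V) : ∫ x, f x ∂μ ∈ V := by
  have : CompleteSpace V := hV.completeSpace_coe
  have := V.subtypeₗᵢ.integral_comp_comm (μ := μ) fun x => (⟨f x, hf x⟩ : V)
  simp only [Submodule.coe_subtypeₗᵢ, Submodule.subtype_apply] at this
  rw [this]
  exact Submodule.coe_mem _

theorem HasDerivAt.mem_of_isClosed {E : Type*} [NormedAddCommGroup E] [NormedSpace ℝ E]
    {V : Submodule ℝ E} (hV : IsClosed (V : Set E)) {f : ℝ → E} {f' : E} {a : ℝ}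
    (hf : ∀ x, f x ∈ V) (h : HasDerivAt f f' a) : f' ∈ V :=
  hV.mem_of_tendsto (hasDerivAt_iff_tendsto_slope.1 h) (Filter.Eventually.of_forall fun x =>
    V.smul_mem _ (V.sub_mem (hf x) (hf a)))

section UniversalApproximation

variable {Q : Type*} [TopologicalSpace Q]

/-- The curve `a ↦ Lᵏ · g (a L + b)` in `C(Q, ℝ)`. -/
noncomputable def powMulComp (L : C(Q, ℝ)) (k : ℕ) (g : C(ℝ, ℝ)) (b : ℝ) : C(ℝ, C(Q, ℝ)) :=
  ContinuousMap.curry ⟨fun p : ℝ × Q => L p.2 ^ k * g (p.1 * L p.2 + b), by fun_prop⟩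

theorem powMulComp_apply (L : C(Q, ℝ)) (k : ℕ) (g : C(ℝ, ℝ)) (b a : ℝ) (q : Q) :
    powMulComp L k g b a q = L q ^ k * g (a * L q + b) := rfl

variable [CompactSpace Q]

/-- Differentiability must hold in sup norm. The curve is the primitive of a continuous `C(Q,
ℝ)`-valued curve, as a pointwise check shows, so the fundamental theorem of calculus applies. -/
theorem hasDerivAt_powMulComp (L : C(Q, ℝ)) (k : ℕ) {g g' : C(ℝ, ℝ)}
    (h : ∀ x, HasDerivAt g (g' x) x) (b a : ℝ) :
    HasDerivAt (powMulComp L k g b) (powMulComp L (k + 1) g' b a) a := by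
  have hc : Continuous (powMulComp L (k + 1) g' b) := (powMulComp L (k + 1) g' b).continuous
  have hF : ∀ x, powMulComp L k g b x =
      powMulComp L k g b 0 + ∫ s in (0 : ℝ)..x, powMulComp L (k + 1) g' b s := by
    intro x
    ext q
    have h1 : (∫ s in (0 : ℝ)..x, powMulComp L (k + 1) g' b s) q =
        ∫ s in (0 : ℝ)..x, powMulComp L (k + 1) g' b s q :=
      ((ContinuousMap.evalCLM ℝ q).intervalIntegral_comp_comm (hc.intervalIntegrable 0 x)).symm
    have h2 : ∀ s, HasDerivAt (fun s => powMulComp L k g b s q)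
        (powMulComp L (k + 1) g' b s q) s := fun s => by
      change HasDerivAt (fun s => L q ^ k * g (s * L q + b))
        (L q ^ (k + 1) * g' (s * L q + b)) s
      have := ((h (s * L q + b)).comp s
        (((hasDerivAt_id s).mul_const (L q)).add_const b)).const_mul (L q ^ k)
      exact this.congr_deriv (by ring)
    rw [ContinuousMap.add_apply, h1, intervalIntegral.integral_eq_sub_of_hasDerivAt
      (fun s _ => h2 s) (Continuous.intervalIntegrable (by
        exact (ContinuousMap.evalCLM ℝ q).continuous.comp hc) _ _)]
    ring
  rw [show (powMulComp L k g b : ℝ → C(Q, ℝ)) = fun x => powMulComp L k g b 0 +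
    ∫ s in (0 : ℝ)..x, powMulComp L (k + 1) g' b s from funext hF]
  exact (intervalIntegral.integral_hasDerivAt_right (hc.intervalIntegrable 0 a)
    hc.stronglyMeasurable.stronglyMeasurableAtFilter hc.continuousAt).const_add _

/-- The closed span of the neurons `σ ∘ L`, for `L` in a class of pre-activations. -/
def neuronSpan (σ : C(ℝ, ℝ)) (𝓛 : Submodule ℝ C(Q, ℝ)) : Submodule ℝ C(Q, ℝ) :=
  (Submodule.span ℝ ((fun L => σ.comp L) '' (𝓛 : Set C(Q, ℝ)))).topologicalClosure

/-- A mollified neuron is an integral of translated neurons, and `a`-derivatives are limits of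
difference quotients; both stay in a closed subspace. -/
theorem pow_mem_neuronSpan {σ : C(ℝ, ℝ)} {C : NNReal} (hσ : LipschitzWith C σ)
    (hna : ¬ ∃ a b : ℝ, ∀ x, σ x = a * x + b) {𝓛 : Submodule ℝ C(Q, ℝ)} (h1 : 1 ∈ 𝓛)
    {L : C(Q, ℝ)} (hL : L ∈ 𝓛) (k : ℕ) : L ^ k ∈ neuronSpan σ 𝓛 := by
  obtain ⟨η, g, hηc, hηs, hg, hgs, hgl, hgna⟩ := exists_smooth_convolution_not_affine hσ hna
  have hV : IsClosed (neuronSpan σ 𝓛 : Set C(Q, ℝ)) := Submodule.isClosed_topologicalClosure _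
  let G : ℕ → C(ℝ, ℝ) := fun k =>
    ⟨iteratedDeriv k g, hgs.continuous_iteratedDeriv k (by exact_mod_cast le_top)⟩
  have hG : ∀ k x, HasDerivAt (G k) (G (k + 1) x) x := fun k x => by
    have := (hgs.differentiable_iteratedDeriv k
      (by exact_mod_cast WithTop.coe_lt_top _)).differentiableAt (x := x) |>.hasDerivAt
    rwa [← iteratedDeriv_succ] at this
  have hmem : ∀ k b a, powMulComp L k (G k) b a ∈ neuronSpan σ 𝓛 := by
    intro k
    induction k with
    | zero =>
      intro b a
      let F : C(ℝ, C(Q, ℝ)) :=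
        ContinuousMap.curry ⟨fun p : ℝ × Q => η p.1 * σ (a * L p.2 + b - p.1), by fun_prop⟩
      have hFa : ∀ t q, F t q = η t * σ (a * L q + b - t) := fun _ _ => rfl
      have hFs : HasCompactSupport F := hηs.mono fun t ht => by
        contrapose! ht
        simp only [Function.mem_support, not_not] at ht ⊢
        ext q
        simp [hFa, ht]
      have hFi : Integrable F := F.continuous.integrable_of_hasCompactSupport hFs
      have : powMulComp L 0 (G 0) b a = ∫ t, F t := by
        ext q
        rw [ContinuousMap.integral_apply hFi]
        simp [powMulComp_apply, G, hg, hFa]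
      rw [this]
      refine integral_mem_of_isClosed _ hV fun t => ?_
      have : F t = η t • σ.comp (a • L + (b - t) • (1 : C(Q, ℝ))) := by
        ext q
        simp [hFa, add_sub_assoc]
      rw [this]
      exact Submodule.smul_mem _ _ (Submodule.le_topologicalClosure _ (Submodule.subset_span
        ⟨_, 𝓛.add_mem (𝓛.smul_mem _ hL) (𝓛.smul_mem _ h1), rfl⟩))
    | succ k ih =>
      intro b a
      exact HasDerivAt.mem_of_isClosed hV (ih b) (hasDerivAt_powMulComp L k (hG k) b a)
  -- At `a = 0` the `k`-th derivative of the curve is `g⁽ᵏ⁾(b) • L ^ k`.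
  obtain ⟨b, hb⟩ := exists_iteratedDeriv_ne_zero hgs hgl hgna k
  have : L ^ k = (iteratedDeriv k g b)⁻¹ • powMulComp L k (G k) b 0 := by
    ext q
    simp [powMulComp_apply, G]
    field_simp
  rw [this]
  exact Submodule.smul_mem _ _ (hmem k b 0)

theorem exp_mem_neuronSpan {σ : C(ℝ, ℝ)} {C : NNReal} (hσ : LipschitzWith C σ)
    (hna : ¬ ∃ a b : ℝ, ∀ x, σ x = a * x + b) {𝓛 : Submodule ℝ C(Q, ℝ)} (h1 : 1 ∈ 𝓛)
    {L : C(Q, ℝ)} (hL : L ∈ 𝓛) : NormedSpace.exp L ∈ neuronSpan σ 𝓛 := by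
  have hV : IsClosed (neuronSpan σ 𝓛 : Set C(Q, ℝ)) := Submodule.isClosed_topologicalClosure _
  refine hV.mem_of_tendsto (NormedSpace.exp_series_hasSum_exp' (𝕂 := ℝ) L)
    (Filter.Eventually.of_forall fun s => Submodule.sum_mem _ fun k _ =>
      Submodule.smul_mem _ _ (pow_mem_neuronSpan hσ hna h1 hL k))

/-- Universal approximation: shallow networks with Lipschitz non-affine activation, whose
pre-activations form a vector space that contains the constants and separates points. -/
theorem neuronSpan_eq_top {σ : C(ℝ, ℝ)} {C : NNReal} (hσ : LipschitzWith C σ)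
    (hna : ¬ ∃ a b : ℝ, ∀ x, σ x = a * x + b) {𝓛 : Submodule ℝ C(Q, ℝ)} (h1 : 1 ∈ 𝓛)
    (hsep : ∀ p q : Q, p ≠ q → ∃ L ∈ 𝓛, L p ≠ L q) : neuronSpan σ 𝓛 = ⊤ := by
  -- Since `exp L * exp L' = exp (L + L')`, the algebra generated by the exponentials is just their
  -- linear span.
  let M : Submonoid C(Q, ℝ) :=
    { carrier := NormedSpace.exp '' (𝓛 : Set C(Q, ℝ))
      one_mem' := ⟨0, 𝓛.zero_mem, NormedSpace.exp_zero⟩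
      mul_mem' := by
        rintro _ _ ⟨L, hL, rfl⟩ ⟨L', hL', rfl⟩
        exact ⟨L + L', 𝓛.add_mem hL hL', NormedSpace.exp_add⟩ }
  let A : Subalgebra ℝ C(Q, ℝ) := Algebra.adjoin ℝ (M : Set C(Q, ℝ))
  have hexp : ∀ (L : C(Q, ℝ)) q, NormedSpace.exp L q = Real.exp (L q) := fun L q => by
    have := (NormedSpace.exp_series_hasSum_exp' (𝕂 := ℝ) L).map
      (ContinuousMap.evalCLM ℝ q : C(Q, ℝ) →L[ℝ] ℝ) (ContinuousMap.evalCLM ℝ q).continuous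
    rw [Real.exp_eq_exp_ℝ]
    exact this.unique (by
      simpa [Function.comp_def] using NormedSpace.exp_series_hasSum_exp' (𝕂 := ℝ) (L q))
  have hA : A.topologicalClosure = ⊤ := by
    refine ContinuousMap.subalgebra_topologicalClosure_eq_top_of_separatesPoints A
      fun p q hpq => ?_
    obtain ⟨L, hL, hLpq⟩ := hsep p q hpq
    refine ⟨_, ⟨NormedSpace.exp L, Algebra.subset_adjoin ⟨L, hL, rfl⟩, rfl⟩, ?_⟩
    simpa [hexp] using hLpq
  have hle : Subalgebra.toSubmodule A ≤ neuronSpan σ 𝓛 := by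
    rw [Algebra.adjoin_eq_span, Submonoid.closure_eq, Submodule.span_le]
    rintro _ ⟨L, hL, rfl⟩
    exact exp_mem_neuronSpan hσ hna h1 hL
  refine eq_top_iff.2 fun f _ => ?_
  have hf : f ∈ A.topologicalClosure := hA ▸ Algebra.mem_top
  exact closure_minimal (s := (A : Set C(Q, ℝ))) hle
    (Submodule.isClosed_topologicalClosure _) hf

end UniversalApproximation

/-! ### Lipschitz continuity of conditioning -/

/-- With masses `a` and `b`, one `1 / δ` comes from changing the numerator at fixed `a`, the other
from changing the mass, where `|b - a|` is itself at most the L¹ distance. -/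
theorem integral_abs_div_sub_div_le {X : Type*} [MeasurableSpace X] {μ : Measure X} {u v : X → ℝ}
    (hu : Integrable u μ) (hv : Integrable v μ) (hv0 : 0 ≤ᵐ[μ] v) {δ : ℝ} (hδ : 0 < δ)
    (ha : δ ≤ ∫ x, u x ∂μ) (hb : δ ≤ ∫ x, v x ∂μ) :
    ∫ x, |u x / (∫ x, u x ∂μ) - v x / (∫ x, v x ∂μ)| ∂μ ≤ 2 / δ * ∫ x, |u x - v x| ∂μ := by
  set a := ∫ x, u x ∂μ with hadef
  set b := ∫ x, v x ∂μ with hbdef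
  have ha0 : 0 < a := hδ.trans_le ha
  have hb0 : 0 < b := hδ.trans_le hb
  have hab : |b - a| ≤ ∫ x, |u x - v x| ∂μ := by
    rw [abs_sub_comm, hadef, hbdef, ← integral_sub hu hv]
    exact abs_integral_le_integral_abs
  calc ∫ x, |u x / a - v x / b| ∂μ
      ≤ ∫ x, (a⁻¹ * |u x - v x| + v x * (|b - a| / (a * b))) ∂μ := by
        refine integral_mono_ae ((hu.div_const a).sub (hv.div_const b)).abs
          (((hu.sub hv).abs.const_mul _).add (hv.mul_const _)) ?_
        filter_upwards [hv0] with x hx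
        have : u x / a - v x / b = a⁻¹ * (u x - v x) + v x * ((b - a) / (a * b)) := by
          field_simp
          ring
        rw [this]
        refine (abs_add_le _ _).trans (le_of_eq ?_)
        rw [abs_mul, abs_mul, abs_div, abs_of_pos (inv_pos.2 ha0), abs_of_nonneg hx,
          abs_of_pos (mul_pos ha0 hb0)]
    _ = a⁻¹ * (∫ x, |u x - v x| ∂μ) + a⁻¹ * |b - a| := by
        rw [integral_add (f := fun x => a⁻¹ * |u x - v x|) ((hu.sub hv).abs.const_mul _)
          (hv.mul_const _), integral_const_mul,
          integral_mul_const, ← hbdef]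
        field_simp
    _ ≤ δ⁻¹ * (∫ x, |u x - v x| ∂μ) + δ⁻¹ * ∫ x, |u x - v x| ∂μ := by
        have := inv_anti₀ hδ ha
        gcongr
    _ = 2 / δ * ∫ x, |u x - v x| ∂μ := by ring

/-! ### Slicing over the second factor, and the Lipschitz bound -/

theorem measurePreserving_append {m r : ℕ} :
    MeasurePreserving (fun p : (Fin m → ℝ) × (Fin r → ℝ) => Fin.append p.1 p.2)
      volume volume := by
  have h1 := volume_measurePreserving_piCongrLeft (fun _ : Fin (m + r) => ℝ)
    (finSumFinEquiv (m := m) (n := r))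
  have h2 := (volume_measurePreserving_sumPiEquivProdPi (fun _ : Fin m ⊕ Fin r => ℝ)).symm
  have h3 := h1.comp h2
  convert h3 using 1
  funext p i
  refine Fin.addCases (fun j => ?_) (fun j => ?_) i
  · have := MeasurableEquiv.piCongrLeft_apply_apply (β := fun _ : Fin (m + r) => ℝ)
      (finSumFinEquiv (m := m) (n := r))
      ((MeasurableEquiv.sumPiEquivProdPi fun _ : Fin m ⊕ Fin r => ℝ).symm p) (Sum.inl j)
    simp only [finSumFinEquiv_apply_left] at this
    simp only [Fin.append_left, Function.comp_apply]
    exact this.symm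
  · have := MeasurableEquiv.piCongrLeft_apply_apply (β := fun _ : Fin (m + r) => ℝ)
      (finSumFinEquiv (m := m) (n := r))
      ((MeasurableEquiv.sumPiEquivProdPi fun _ : Fin m ⊕ Fin r => ℝ).symm p) (Sum.inr j)
    simp only [finSumFinEquiv_apply_right] at this
    simp only [Fin.append_right, Function.comp_apply]
    exact this.symm

theorem query_append {m r : ℕ} (x : Fin m → ℝ) (y : Fin r → ℝ) : query (Fin.append x y) = y := by
  ext j
  simp [query]

theorem setLIntegral_strip {m r : ℕ} {B : Set (Fin r → ℝ)} (hB : MeasurableSet B)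
    {F : (Fin (m + r) → ℝ) → ℝ≥0∞} (hF : Measurable F) :
    ∫⁻ z in strip m B, F z = ∫⁻ y in B, ∫⁻ x : Fin m → ℝ, F (Fin.append x y) := by
  have hpre : (fun p : (Fin m → ℝ) × (Fin r → ℝ) => Fin.append p.1 p.2) ⁻¹' strip m B =
      Set.univ ×ˢ B := by
    ext p
    simp [strip, query_append]
  have hstrip : MeasurableSet (strip m B) := measurable_query hB
  rw [← measurePreserving_append.setLIntegral_comp_preimage hstrip hF, hpre,
    Measure.volume_eq_prod, ← Measure.prod_restrict, Measure.restrict_univ]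
  exact lintegral_prod_symm' _ (hF.comp measurable_append)

theorem ae_integrable_append {m r : ℕ} {f : (Fin (m + r) → ℝ) → ℝ} (hf : Integrable f) :
    ∀ᵐ y : Fin r → ℝ, Integrable fun x : Fin m → ℝ => f (Fin.append x y) := by
  have h : Integrable (fun p : (Fin m → ℝ) × (Fin r → ℝ) => f (Fin.append p.1 p.2)) volume :=
    measurePreserving_append.integrable_comp_of_integrable hf
  rw [Measure.volume_eq_prod] at h
  exact h.prod_left_ae

theorem ae_ae_append {m r : ℕ} {p : (Fin (m + r) → ℝ) → Prop} (hp : ∀ᵐ z, p z) :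
    ∀ᵐ y : Fin r → ℝ, ∀ᵐ x : Fin m → ℝ, p (Fin.append x y) := by
  have h : ∀ᵐ q : (Fin m → ℝ) × (Fin r → ℝ), p (Fin.append q.1 q.2) :=
    measurePreserving_append.quasiMeasurePreserving.ae hp
  rw [Measure.volume_eq_prod] at h
  have h2 := Measure.ae_ae_of_ae_prod
    ((Measure.measurePreserving_swap (μ := (volume : Measure (Fin r → ℝ)))
      (ν := (volume : Measure (Fin m → ℝ)))).quasiMeasurePreserving.ae h)
  exact h2

theorem ae_le_marginal {m r : ℕ} {δ : ℝ} {B : Set (Fin r → ℝ)} {f : L1 (m + r)}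
    (hf : f ∈ densitiesBoundedBelow m δ B) : ∀ᵐ y ∂(volume.restrict B), δ ≤ marginal f y := by
  filter_upwards [ae_essInf_le (f := fun y => ((marginal f y : ℝ) : EReal))
    (μ := volume.restrict B)] with y hy
  exact EReal.coe_le_coe_iff.1 (hf.2.trans hy)

/-- The estimate `integral_abs_div_sub_div_le` holds on almost every fibre over `B` and is
integrated by Tonelli. -/
theorem lipschitzWith_kernelConditioning {m r : ℕ} {δ : ℝ} (hδ : 0 < δ) {B : Set (Fin r → ℝ)}
    (hB : MeasurableSet B) :
    LipschitzWith (2 / δ).toNNReal (kernelConditioning (m := m) hδ hB) := by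
  rintro ⟨f, hf⟩ ⟨g, hg⟩
  have hmf : ∀ f : L1 (m + r), Measurable (kernelFun f) := fun f =>
    (Lp.stronglyMeasurable f).measurable.div ((measurable_marginal f).comp measurable_query)
  have hfm := (Lp.stronglyMeasurable f).measurable
  have hgm := (Lp.stronglyMeasurable g).measurable
  have hfi := L1.integrable_coeFn f
  have hgi := L1.integrable_coeFn g
  rw [Subtype.edist_mk_mk, kernelConditioning, kernelConditioning,
    Lp.edist_toLp_toLp, Lp.edist_def, eLpNorm_one_eq_lintegral_enorm,
    eLpNorm_one_eq_lintegral_enorm,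
    ENNReal.ofNNReal_toNNReal]
  simp only [Pi.sub_apply]
  calc ∫⁻ z in strip m B, ‖kernelFun f z - kernelFun g z‖ₑ
      = ∫⁻ y in B, ∫⁻ x : Fin m → ℝ,
          ‖kernelFun f (Fin.append x y) - kernelFun g (Fin.append x y)‖ₑ :=
        setLIntegral_strip hB ((hmf f).sub (hmf g)).enorm
    _ ≤ ∫⁻ y in B, ENNReal.ofReal (2 / δ) *
          ∫⁻ x : Fin m → ℝ, ‖f (Fin.append x y) - g (Fin.append x y)‖ₑ := by
        refine lintegral_mono_ae ?_
        filter_upwards [ae_le_marginal hf, ae_le_marginal hg,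
          ae_restrict_of_ae (ae_integrable_append hfi),
          ae_restrict_of_ae (ae_integrable_append hgi),
          ae_restrict_of_ae (ae_ae_append hg.1.1)] with y h1 h2 h3 h4 h5
        have := integral_abs_div_sub_div_le h3 h4 h5 hδ h1 h2
        simp only [kernelFun, query_append]
        rw [← ofReal_integral_norm_eq_lintegral_enorm (f := fun x : Fin m → ℝ =>
            f (Fin.append x y) / marginal f y - g (Fin.append x y) / marginal g y)
            ((h3.div_const _).sub (h4.div_const _)),
          ← ofReal_integral_norm_eq_lintegral_enorm (f := fun x : Fin m → ℝ =>
            f (Fin.append x y) - g (Fin.append x y)) (h3.sub h4),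
          ← ENNReal.ofReal_mul (by positivity)]
        exact ENNReal.ofReal_le_ofReal this
    _ = ENNReal.ofReal (2 / δ) * ∫⁻ z in strip m B, ‖f z - g z‖ₑ := by
        rw [lintegral_const_mul' _ _ ENNReal.ofReal_ne_top,
          setLIntegral_strip (F := fun z => ‖f z - g z‖ₑ) hB (hfm.sub hgm).enorm]
    _ ≤ ENNReal.ofReal (2 / δ) * ∫⁻ z, ‖f z - g z‖ₑ := by
        gcongr
        exact Measure.restrict_le_self

/-! ### Shallow networks in the variable `x` and in finitely many functionals of the input -/

theorem isShallowReLU_id : IsShallowReLU id := by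
  refine ⟨2, ![1, -1], ![1, -1], 0, 0, fun z => ?_⟩
  simp only [Fin.sum_univ_two, Matrix.cons_val_zero, Matrix.cons_val_one, Pi.zero_apply, id]
  rcases le_total z 0 with h | h
  · rw [max_eq_right (by linarith), max_eq_left (by linarith)]; ring
  · rw [max_eq_left (by linarith), max_eq_right (by linarith)]; ring

theorem cube_subset_Icc (n : ℕ) (R : ℝ) : cube n R ⊆ Set.Icc (fun _ => -R) (fun _ => R) :=
  fun _ hx => ⟨fun i => (hx i trivial).1.le, fun i => (hx i trivial).2.le⟩

instance isFiniteMeasure_cube (n : ℕ) (R : ℝ) :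
    IsFiniteMeasure ((volume : Measure (Fin n → ℝ)).restrict (cube n R)) :=
  ⟨by
    rw [Measure.restrict_apply_univ]
    exact (measure_mono (cube_subset_Icc n R)).trans_lt isCompact_Icc.measure_lt_top⟩

/-- The network `∑ᵢ cᵢ σ(wᵢ·x + bᵢ + ∫_Ω f ψᵢ)` as a function of `x`. -/
noncomputable def functionalNet (σ : ℝ → ℝ) {n p : ℕ} (Ω : Set (Fin n → ℝ)) (c : Fin p → ℝ)
    (w : Fin p → Fin n → ℝ) (b : Fin p → ℝ) (ψ : Fin p → (Fin n → ℝ) → ℝ)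
    (f : (Fin n → ℝ) → ℝ) (x : Fin n → ℝ) : ℝ :=
  ∑ i, c i * σ (w i ⬝ᵥ x + b i + ∫ z in Ω, f z * ψ i z)

/-- The lift is the identity on `(x, f x)`. The weights read only `x`, the encoders only the last
coordinate `f x`, and the constant decoder `Pi.single k 1` sends the `k`-th functional to the `k`-th
neuron; the projection sums with weights `c`. -/
theorem exists_neuralOperator_eval_eq_functionalNet (σ : ℝ → ℝ) {n p : ℕ} {Ω : Set (Fin n → ℝ)}
    [IsFiniteMeasure ((volume : Measure (Fin n → ℝ)).restrict Ω)] (c : Fin p → ℝ)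
    (w : Fin p → Fin n → ℝ) (b : Fin p → ℝ) (ψ : Fin p → (Fin n → ℝ) → ℝ)
    (hψ : ∀ k, MemLp (ψ k) ∞ (volume.restrict Ω)) :
    ∃ N : NeuralOperator Ω 1 1, ∀ f : (Fin n → ℝ) → ℝ, ∀ x,
      N.eval σ (fun z _ => f z) x 0 = functionalNet σ Ω c w b ψ f x := by
  let e : ℝ →L[ℝ] (Fin (n + 1) → ℝ) :=
    ContinuousLinearMap.toSpanSingleton ℝ (Pi.single (Fin.last n) 1)
  let l : HiddenLayer Ω (n + 1) p :=
    { W := fun i => Fin.append (w i) 0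
      bias := b
      M := p
      T := fun _ => 1
      ψ := fun k z => e (ψ k z)
      φ := fun k _ => Pi.single k 1
      ψ_memLp_one := fun k => e.comp_memLp' ((hψ k).mono_exponent le_top)
      ψ_memLp_top := fun k => e.comp_memLp' (hψ k)
      φ_memLp_one := fun k => memLp_const _ }
  have hl : ∀ (f : (Fin n → ℝ) → ℝ) x i, l.eval σ (fun z => Fin.append z fun _ => f z) x i =
      σ (w i ⬝ᵥ x + b i + ∫ z in Ω, f z * ψ i z) := fun f x i => by
    have hW : (l.W *ᵥ Fin.append x fun _ : Fin 1 => f x) i = w i ⬝ᵥ x := by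
      simp [l, Matrix.mulVec, dotProduct, Fin.sum_univ_add]
    have hT : ∀ k : Fin p, ∫ z in Ω, (l.T k *ᵥ Fin.append z fun _ : Fin 1 => f z) ⬝ᵥ l.ψ k z =
        ∫ z in Ω, f z * ψ k z := fun k => by
      refine integral_congr_ae (Filter.Eventually.of_forall fun z => ?_)
      have hlast : Fin.append z (fun _ : Fin 1 => f z) (Fin.last n) = f z :=
        Fin.append_right z (fun _ : Fin 1 => f z) 0
      simp [l, e, hlast, mul_comm]
    have hsum : (∑ k : Fin p, (∫ z in Ω, (l.T k *ᵥ Fin.append z fun _ : Fin 1 => f z) ⬝ᵥ l.ψ k z) •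
        l.φ k x) i = ∫ z in Ω, f z * ψ i z := by
      rw [Finset.sum_apply]
      simp only [hT]
      simp [l, Pi.single_apply]
    change σ (((l.W *ᵥ Fin.append x fun _ : Fin 1 => f x) i + b i) + _) = _
    exact congrArg (fun t => σ t) (congrArg₂ (· + ·) (congrArg (· + b i) hW) hsum)
  refine ⟨⟨n + 1, p, .affine 1 0, .single l, .affine (fun _ => Fin.append 0 c) 0⟩, fun f x => ?_⟩
  simp only [NeuralOperator.eval, NeuralNet.eval, HiddenStack.eval, functionalNet,
    Matrix.one_mulVec, add_zero, Matrix.mulVec, dotProduct, Fin.sum_univ_add, Fin.append_left,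
    Fin.append_right, Pi.zero_apply, zero_mul, Finset.sum_const_zero, zero_add]
  exact Finset.sum_congr rfl fun i _ => congrArg (c i * ·) (hl f x i)

theorem continuous_functionalNet {σ : ℝ → ℝ} (hσ : Continuous σ) {n p : ℕ} (Ω : Set (Fin n → ℝ))
    (c : Fin p → ℝ) (w : Fin p → Fin n → ℝ) (b : Fin p → ℝ) (ψ : Fin p → (Fin n → ℝ) → ℝ)
    (f : (Fin n → ℝ) → ℝ) : Continuous (functionalNet σ Ω c w b ψ f) := by
  unfold functionalNet
  simp only [dotProduct]
  fun_prop

theorem memLp_cube_of_continuous {n : ℕ} {g : (Fin n → ℝ) → ℝ} (hg : Continuous g) (R : ℝ) :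
    MemLp g 1 (volume.restrict (cube n R)) :=
  memLp_one_iff_integrable.2
    ((hg.continuousOn.integrableOn_compact isCompact_Icc).mono_set (cube_subset_Icc n R))

theorem restriction_ae_eq {n : ℕ} (Ω : Set (Fin n → ℝ)) (f : L1 n) :
    restriction Ω f =ᵐ[volume.restrict Ω] f :=
  MemLp.coeFn_toLp _

theorem exists_isFullNO_ae_eq {σ : ℝ → ℝ} (hσ : Continuous σ) {n p : ℕ} (R : ℝ)
    (c : Fin p → ℝ) (w : Fin p → Fin n → ℝ) (b : Fin p → ℝ) (ψ : Fin p → (Fin n → ℝ) → ℝ)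
    (hψ : ∀ k, MemLp (ψ k) ∞ (volume.restrict (cube n R))) :
    ∃ Ψ : L1 n → L1 n, IsFullNO σ (measurableSet_cube n R) Ψ ∧
      ∀ f, Ψ f =ᵐ[volume]
        (cube n R).indicator (functionalNet σ (cube n R) c w b ψ (restriction (cube n R) f)) := by
  let Ψ₀ : L1On (cube n R) → L1On (cube n R) := fun u =>
    (memLp_cube_of_continuous (continuous_functionalNet hσ (cube n R) c w b ψ u) R).toLp _
  have hΨ₀ : ∀ u, Ψ₀ u =ᵐ[volume.restrict (cube n R)]
      functionalNet σ (cube n R) c w b ψ u := fun u => MemLp.coeFn_toLp _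
  -- The pointwise ReLU network is taken to be the identity, `z = max z 0 - max (-z) 0`.
  refine ⟨fun f => zeroExtension (measurableSet_cube n R) (Ψ₀ (restriction (cube n R) f)),
    ⟨id, id, Ψ₀, isShallowReLU_id, fun _ => ae_eq_refl _, ?_, fun _ => rfl⟩, fun f => ?_⟩
  · obtain ⟨N, hN⟩ := exists_neuralOperator_eval_eq_functionalNet σ c w b ψ hψ
    refine ⟨N, fun u => ?_⟩
    simp only [hN]
    exact hΨ₀ u
  · refine (MemLp.coeFn_toLp _).trans ?_
    exact (ae_eq_restrict_iff_indicator_ae_eq (measurableSet_cube n R)).1 (hΨ₀ _)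

/-! ### Universal approximation on compact sets of inputs -/

/-- Affine pre-activations `(u, x) ↦ w·x + b + ∫_Ω u ψ` with bounded `ψ`. -/
def preactivations {n : ℕ} {Ω : Set (Fin n → ℝ)} (U : Set (L1On Ω)) (X : Set (Fin n → ℝ)) :
    Submodule ℝ C(U × X, ℝ) where
  carrier := {L | ∃ (w : Fin n → ℝ) (b : ℝ) (ψ : (Fin n → ℝ) → ℝ),
    MemLp ψ ∞ (volume.restrict Ω) ∧
      ∀ q : U × X, L q = w ⬝ᵥ q.2 + b + ∫ z in Ω, (q.1 : L1On Ω) z * ψ z}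
  zero_mem' := ⟨0, 0, 0, MemLp.zero, fun q => by simp⟩
  add_mem' := by
    rintro L L' ⟨w, b, ψ, hψ, hL⟩ ⟨w', b', ψ', hψ', hL'⟩
    refine ⟨w + w', b + b', ψ + ψ', hψ.add hψ', fun q => ?_⟩
    have hu := L1.integrable_coeFn (q.1 : L1On Ω)
    simp only [ContinuousMap.add_apply, hL, hL', add_dotProduct, Pi.add_apply, mul_add]
    rw [integral_add (f := fun z => (q.1 : L1On Ω) z * ψ z) (g := fun z => (q.1 : L1On Ω) z * ψ' z)
      (hu.mul_of_top_left hψ) (hu.mul_of_top_left hψ')]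
    ring
  smul_mem' := by
    rintro a L ⟨w, b, ψ, hψ, hL⟩
    refine ⟨a • w, a * b, a • ψ, hψ.const_smul a, fun q => ?_⟩
    simp only [ContinuousMap.smul_apply, hL, smul_dotProduct, Pi.smul_apply, smul_eq_mul,
      mul_left_comm _ a, integral_const_mul]
    ring

/-- Taking `ψ` to be an indicator gives the integral over a measurable set, and these integrals
determine an L¹ function; coordinate functions separate the points of `X`. -/
theorem preactivations_separate {n : ℕ} {Ω : Set (Fin n → ℝ)} (U : Set (L1On Ω))
    (X : Set (Fin n → ℝ)) {p q : U × X} (hpq : p ≠ q) :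
    ∃ L ∈ preactivations U X, L p ≠ L q := by
  by_contra! hcon
  refine hpq (Prod.ext (Subtype.ext (Lp.ext ?_)) (Subtype.ext (funext fun i => ?_)))
  · refine Integrable.ae_eq_of_forall_setIntegral_eq _ _ (L1.integrable_coeFn _)
      (L1.integrable_coeFn _) fun A hA _ => ?_
    let L : C(U × X, ℝ) := ⟨fun q => ∫ z in A, (q.1 : L1On Ω) z ∂(volume.restrict Ω),
      (continuous_setIntegral A).comp (continuous_subtype_val.comp continuous_fst)⟩
    refine hcon L ⟨0, 0, A.indicator 1, ?_, fun q => ?_⟩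
    · exact memLp_top_const (1 : ℝ) |>.indicator hA
    · simp only [L, ContinuousMap.coe_mk, zero_dotProduct, zero_add]
      rw [← integral_indicator hA]
      congr 1
      ext z
      by_cases hz : z ∈ A <;> simp [hz]
  · refine hcon ⟨fun q => (q.2 : Fin n → ℝ) i,
      (continuous_apply i).comp (continuous_subtype_val.comp continuous_snd)⟩
      ⟨Pi.single i 1, 0, 0, MemLp.zero, fun q => by simp⟩

theorem exists_functionalNet_approx {σ : ℝ → ℝ} {C : NNReal} (hσ : LipschitzWith C σ)
    (hna : ¬ ∃ a b : ℝ, ∀ x, σ x = a * x + b) {n : ℕ} {Ω : Set (Fin n → ℝ)}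
    {U : Set (L1On Ω)} (hU : IsCompact U) {X : Set (Fin n → ℝ)}
    (hX : IsCompact X) (H : C(U × X, ℝ)) {ε : ℝ} (hε : 0 < ε) :
    ∃ (p : ℕ) (c : Fin p → ℝ) (w : Fin p → Fin n → ℝ) (b : Fin p → ℝ)
      (ψ : Fin p → (Fin n → ℝ) → ℝ), (∀ k, MemLp (ψ k) ∞ (volume.restrict Ω)) ∧
      ∀ q : U × X, |H q - functionalNet σ Ω c w b ψ (q.1 : L1On Ω) q.2| ≤ ε := by
  have := isCompact_iff_compactSpace.1 hU
  have := isCompact_iff_compactSpace.1 hX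
  let s : C(ℝ, ℝ) := ⟨σ, hσ.continuous⟩
  have htop : neuronSpan s (preactivations U X) = ⊤ :=
    neuronSpan_eq_top (C := C) hσ hna ⟨0, 1, 0, MemLp.zero, fun q => by simp⟩
      fun p q hpq => preactivations_separate U X hpq
  have hH : H ∈ neuronSpan s (preactivations U X) := htop ▸ Submodule.mem_top
  obtain ⟨F, hF, hHF⟩ := Metric.mem_closure_iff.1 hH ε hε
  obtain ⟨p, c, g, rfl⟩ := (Submodule.mem_span_set' (R := ℝ)).1 hF
  choose L hL hLg using fun i => (g i).2
  choose w b ψ hψ hLe using hL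
  refine ⟨p, c, w, b, ψ, hψ, fun q => ?_⟩
  have h1 := (ContinuousMap.dist_apply_le_dist (f := H) (g := ∑ i, c i • (g i : C(U × X, ℝ))) q)
  have h2 : (∑ i, c i • (g i : C(U × X, ℝ))) q =
      functionalNet σ Ω c w b ψ (q.1 : L1On Ω) q.2 := by
    simp only [functionalNet, ContinuousMap.sum_apply, ContinuousMap.smul_apply, ← hLg,
      ContinuousMap.comp_apply, hLe, smul_eq_mul]
    rfl
  rw [h2] at h1
  exact h1.trans hHF.le

/-! ### Restriction to large cubes -/

theorem restriction_sub {n : ℕ} (Ω : Set (Fin n → ℝ)) (f g : L1 n) :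
    restriction Ω (f - g) = restriction Ω f - restriction Ω g := by
  refine Lp.ext ?_
  filter_upwards [restriction_ae_eq Ω (f - g), restriction_ae_eq Ω f, restriction_ae_eq Ω g,
    Lp.coeFn_sub (restriction Ω f) (restriction Ω g), ae_restrict_of_ae (Lp.coeFn_sub f g)]
    with x h1 h2 h3 h4 h5
  rw [h1, h4, h5, Pi.sub_apply, Pi.sub_apply, h2, h3]

theorem norm_restriction {n : ℕ} (Ω : Set (Fin n → ℝ)) (f : L1 n) :
    ‖restriction Ω f‖ = ∫ x in Ω, ‖f x‖ := by
  rw [L1.norm_eq_integral_norm]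
  refine integral_congr_ae ?_
  filter_upwards [restriction_ae_eq Ω f] with x hx
  rw [hx]

theorem norm_eq_norm_restriction_add {n : ℕ} {Ω : Set (Fin n → ℝ)} (hΩ : MeasurableSet Ω)
    (f : L1 n) : ‖f‖ = ‖restriction Ω f‖ + ‖restriction Ωᶜ f‖ := by
  rw [norm_restriction, norm_restriction, L1.norm_eq_integral_norm,
    integral_add_compl hΩ (L1.integrable_coeFn f).norm]

theorem norm_restriction_le {n : ℕ} {Ω : Set (Fin n → ℝ)} (hΩ : MeasurableSet Ω)
    (f : L1 n) : ‖restriction Ω f‖ ≤ ‖f‖ := by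
  rw [norm_eq_norm_restriction_add hΩ f]
  exact le_add_of_nonneg_right (norm_nonneg _)

theorem continuous_restriction {n : ℕ} {Ω : Set (Fin n → ℝ)} (hΩ : MeasurableSet Ω) :
    Continuous (restriction Ω) :=
  (LipschitzWith.of_dist_le_mul (K := 1) fun f g => by
    rw [dist_eq_norm, dist_eq_norm, ← restriction_sub, NNReal.coe_one, one_mul]
    exact norm_restriction_le hΩ _).continuous

theorem eventually_subset_cube {n : ℕ} {s : Set (Fin n → ℝ)} (hs : Bornology.IsBounded s) :
    ∀ᶠ k : ℕ in Filter.atTop, s ⊆ cube n k := by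
  obtain ⟨C, hC⟩ := hs.exists_norm_le
  filter_upwards [Filter.eventually_gt_atTop ⌈C⌉₊] with k hk x hx i _
  have h1 : |x i| ≤ C := (norm_le_pi_norm x i).trans (hC x hx)
  have h2 : C < k := (Nat.le_ceil C).trans_lt (by exact_mod_cast hk)
  exact abs_lt.1 (h1.trans_lt h2)

theorem tendsto_norm_restriction_compl_cube {n : ℕ} (f : L1 n) :
    Filter.Tendsto (fun k : ℕ => ‖restriction (cube n k)ᶜ f‖) Filter.atTop (nhds 0) := by
  simp only [norm_restriction]
  have hanti : Antitone fun k : ℕ => (cube n k)ᶜ := fun k l hkl => by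
    refine Set.compl_subset_compl.2 (Set.pi_mono fun i _ => Set.Ioo_subset_Ioo ?_ ?_) <;> simpa
  have := tendsto_setIntegral_of_antitone (μ := (volume : Measure (Fin n → ℝ)))
    (fun k : ℕ => (measurableSet_cube n k).compl) hanti
    ⟨0, (L1.integrable_coeFn f).norm.integrableOn⟩
  have hempty : ⋂ k : ℕ, (cube n (k : ℝ))ᶜ = ∅ := by
    rw [← Set.compl_iUnion, Set.compl_empty_iff, Set.eq_univ_iff_forall]
    intro x
    obtain ⟨k, hk⟩ := (eventually_subset_cube (Bornology.isBounded_singleton (x := x))).exists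
    exact Set.mem_iUnion.2 ⟨k, hk rfl⟩
  rw [hempty] at this
  simpa using this

/-! ### Finite-rank approximation and assembly of the operator -/

theorem exists_continuous_compact_support_approx {n : ℕ} {T : Set (Fin n → ℝ)}
    (hT : MeasurableSet T) (f : L1On T) {ε : ℝ} (hε : 0 < ε) :
    ∃ (φ : (Fin n → ℝ) → ℝ) (hφ : MemLp φ 1 (volume.restrict T)),
      Continuous φ ∧ HasCompactSupport φ ∧ ‖f - hφ.toLp φ‖ ≤ ε := by
  have hind : MemLp (T.indicator f) 1 (volume : Measure (Fin n → ℝ)) :=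
    (memLp_indicator_iff_restrict hT).2 (Lp.memLp f)
  obtain ⟨φ, hφs, hφ, hφc, hφm⟩ := hind.exists_hasCompactSupport_eLpNorm_sub_le
    ENNReal.one_ne_top (ENNReal.ofReal_pos.2 hε).ne'
  refine ⟨φ, hφm.restrict T, hφc, hφs, ?_⟩
  have h1 : eLpNorm (⇑f - φ) 1 (volume.restrict T) ≤ ENNReal.ofReal ε := by
    refine le_trans (le_of_eq (eLpNorm_congr_ae ?_))
      ((eLpNorm_mono_measure _ Measure.restrict_le_self).trans hφ)
    filter_upwards [ae_restrict_mem hT] with x hx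
    simp [hx]
  conv_lhs => rw [← Lp.toLp_coeFn f (Lp.memLp f)]
  rw [← MemLp.toLp_sub, Lp.norm_toLp]
  exact ENNReal.toReal_le_of_le_ofReal hε.le h1

theorem norm_sub_le_of_abs_sub_le_indicator {n : ℕ} {T Ω : Set (Fin n → ℝ)}
    (hΩ : MeasurableSet Ω) [IsFiniteMeasure ((volume : Measure (Fin n → ℝ)).restrict Ω)]
    {f g : L1On T} {a : ℝ} (ha : 0 ≤ a)
    (h : ∀ᵐ x ∂(volume.restrict T), |f x - g x| ≤ Ω.indicator (fun _ => a) x) :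
    ‖f - g‖ ≤ a * (volume.restrict Ω).real Set.univ := by
  have hi : Integrable (Ω.indicator fun _ => a) (volume : Measure (Fin n → ℝ)) :=
    (integrable_indicator_iff hΩ).2 (integrable_const a)
  rw [L1.norm_eq_integral_norm]
  calc ∫ x in T, ‖(f - g) x‖ ≤ ∫ x in T, Ω.indicator (fun _ => a) x := by
        refine integral_mono_ae (L1.integrable_coeFn _).norm hi.restrict ?_
        filter_upwards [h, Lp.coeFn_sub f g] with x hx hx'
        rw [hx']
        exact hx
    _ ≤ ∫ x, Ω.indicator (fun _ => a) x :=
        setIntegral_le_integral hi (Filter.Eventually.of_forall fun x =>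
          Set.indicator_nonneg (fun _ _ => ha) x)
    _ = a * (volume.restrict Ω).real Set.univ := by
        rw [integral_indicator hΩ, integral_const, smul_eq_mul, mul_comm]

/-- A continuous map on a compact set of inputs is approximately a finite-rank map with continuous
compactly supported ranges, with weights that depend continuously on the restriction of the
input to a large cube. -/
theorem exists_finite_rank_approx {n : ℕ} {T : Set (Fin n → ℝ)} (hT : MeasurableSet T)
    {K : Set (L1 n)} (hK : IsCompact K) {G : K → L1On T} (hG : Continuous G) {ε : ℝ}
    (hε : 0 < ε) :
    ∃ R : ℝ, 0 < R ∧ ∃ (ι : Type) (_ : Fintype ι) (φ : ι → (Fin n → ℝ) → ℝ)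
      (hφ : ∀ j, MemLp (φ j) 1 (volume.restrict T)) (c : ι → L1On (cube n R) → ℝ),
      (∀ j, Continuous (φ j)) ∧ (∀ j, ∀ x ∉ cube n R, φ j x = 0) ∧
      (∀ j, ContinuousOn (c j) (restriction (cube n R) '' K)) ∧
      ∀ ρ : K, ‖G ρ - ∑ j, c j (restriction (cube n R) ρ) • (hφ j).toLp (φ j)‖ ≤ ε := by
  have hKc := isCompact_iff_compactSpace.1 hK
  obtain ⟨η, hη, hGη⟩ := Metric.uniformContinuous_iff.1
    (CompactSpace.uniformContinuous_of_continuous hG) (ε / 2) (by positivity)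
  obtain ⟨t, -, htf, ht⟩ := (isCompact_univ (X := K)).finite_cover_balls
    (show 0 < η / 8 by positivity)
  obtain ⟨N, ⟨e⟩⟩ := htf.to_subtype.exists_equiv_fin
  let pt : Fin N → K := fun j => (e.symm j : K)
  have hpt : ∀ ρ : K, ∃ j, dist ρ (pt j) < η / 8 := fun ρ => by
    obtain ⟨x, hx, hρ⟩ := Set.mem_iUnion₂.1 (ht (Set.mem_univ ρ))
    exact ⟨e ⟨x, hx⟩, by simpa [pt] using hρ⟩
  choose φ hφ hφc hφs hφG using fun j => exists_continuous_compact_support_approx hT (G (pt j))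
    (show 0 < ε / 2 by positivity)
  obtain ⟨k, hk0, hksupp, hktail⟩ := ((Filter.eventually_gt_atTop 0).and
    ((Filter.eventually_all.2 fun j => eventually_subset_cube (hφs j).isBounded).and
      (Filter.eventually_all.2 fun j =>
        (tendsto_norm_restriction_compl_cube (pt j : L1 n)).eventually_lt_const
          (show 0 < η / 8 by positivity)))).exists
  set Ω := cube n (k : ℝ) with hΩdef
  have hΩ : MeasurableSet Ω := measurableSet_cube n _
  -- Hat functions of radius `η / 2` in the restricted input. Each `ρ` is within `η / 8` of some net
  -- point and restriction is a contraction, so their sum is positive on the image of `K`.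
  let p : Fin N → L1On Ω → ℝ := fun j u => max 0 (η / 2 - ‖u - restriction Ω (pt j)‖)
  have hp0 : ∀ j u, 0 ≤ p j u := fun j u => le_max_left _ _
  have hpc : ∀ j, Continuous (p j) := fun j => by fun_prop
  have hpsum : ∀ ρ : K, 0 < ∑ j, p j (restriction Ω ρ) := fun ρ => by
    obtain ⟨j, hj⟩ := hpt ρ
    refine Finset.sum_pos' (fun j _ => hp0 j _) ⟨j, Finset.mem_univ j, lt_max_of_lt_right ?_⟩
    have h1 := norm_restriction_le hΩ ((ρ : L1 n) - pt j)
    rw [Subtype.dist_eq, dist_eq_norm] at hj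
    rw [← restriction_sub]
    linarith
  have hnear : ∀ (ρ : K) j, p j (restriction Ω ρ) ≠ 0 → ‖G ρ - (hφ j).toLp (φ j)‖ ≤ ε := by
    intro ρ j hj
    have h1 : ‖restriction Ω ((ρ : L1 n) - pt j)‖ < η / 2 := by
      rw [restriction_sub]
      by_contra! hcon
      exact hj (max_eq_left (by linarith))
    obtain ⟨i, hi⟩ := hpt ρ
    rw [Subtype.dist_eq, dist_eq_norm] at hi
    have h2 := norm_restriction_le hΩ.compl ((ρ : L1 n) - pt i)
    -- The weight does not see `ρ` outside `Ω`, so that part is compared with a nearby net point `pt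
    -- i`, whose tail is small: `3 * (η / 8)` outside and `η / 2` inside stay below `η`.
    have h3 : ‖restriction Ωᶜ ((ρ : L1 n) - pt j)‖ ≤
        ‖restriction Ωᶜ ((ρ : L1 n) - pt i)‖ + ‖restriction Ωᶜ (pt i : L1 n)‖ +
          ‖restriction Ωᶜ (pt j : L1 n)‖ := by
      rw [restriction_sub, restriction_sub]
      refine le_trans (le_of_eq (congrArg norm ?_)) ((norm_sub_le _ _).trans
        (add_le_add_left (norm_add_le _ _) _))
      abel
    have h4 : dist ρ (pt j) < η := by
      rw [Subtype.dist_eq, dist_eq_norm, norm_eq_norm_restriction_add hΩ]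
      linarith [hktail i, hktail j]
    have h5 := hGη h4
    rw [dist_eq_norm] at h5
    calc ‖G ρ - (hφ j).toLp (φ j)‖
        = ‖(G ρ - G (pt j)) + (G (pt j) - (hφ j).toLp (φ j))‖ := by rw [sub_add_sub_cancel]
      _ ≤ ‖G ρ - G (pt j)‖ + ‖G (pt j) - (hφ j).toLp (φ j)‖ := norm_add_le _ _
      _ ≤ ε := by linarith [hφG j]
  refine ⟨k, by exact_mod_cast hk0, Fin N, inferInstance, φ, hφ,
    fun j u => p j u / ∑ i, p i u, hφc, fun j x hx => ?_, fun j => ?_, fun ρ => ?_⟩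
  · by_contra hne
    exact hx (hksupp j (subset_tsupport _ hne))
  · refine (hpc j).continuousOn.div (continuous_finsetSum _ fun i _ => hpc i).continuousOn ?_
    rintro _ ⟨ρ, hρ, rfl⟩
    exact (hpsum ⟨ρ, hρ⟩).ne'
  · set s := ∑ i, p i (restriction Ω ρ) with hs
    have hs0 : 0 < s := hpsum ρ
    have hone : ∑ j, p j (restriction Ω ρ) / s = 1 := by
      rw [← Finset.sum_div, ← hs, div_self hs0.ne']
    calc ‖G ρ - ∑ j, (p j (restriction Ω ρ) / s) • (hφ j).toLp (φ j)‖
        = ‖∑ j, (p j (restriction Ω ρ) / s) • (G ρ - (hφ j).toLp (φ j))‖ := by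
          simp only [smul_sub, Finset.sum_sub_distrib, ← Finset.sum_smul, hone, one_smul]
      _ ≤ ∑ j, p j (restriction Ω ρ) / s * ε := by
          refine (norm_sum_le _ _).trans (Finset.sum_le_sum fun j _ => ?_)
          rw [norm_smul, Real.norm_of_nonneg (div_nonneg (hp0 j _) hs0.le)]
          by_cases hj : p j (restriction Ω ρ) = 0
          · simp [hj]
          · exact mul_le_mul_of_nonneg_left (hnear ρ j hj) (div_nonneg (hp0 j _) hs0.le)
      _ = ε := by rw [← Finset.sum_mul, hone, one_mul]

/-- Universal approximation by full space neural operators of continuous maps on compact sets. -/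
theorem exists_isFullNO_approx {σ : ℝ → ℝ} {C : NNReal} (hσ : LipschitzWith C σ)
    (hna : ¬ ∃ a b : ℝ, ∀ x, σ x = a * x + b) {n : ℕ} {T : Set (Fin n → ℝ)}
    (hT : MeasurableSet T) {K : Set (L1 n)} (hK : IsCompact K) {G : K → L1On T}
    (hG : Continuous G) {ε : ℝ} (hε : 0 < ε) :
    ∃ R : ℝ, 0 < R ∧ ∃ Ψ : L1 n → L1 n, IsFullNO σ (measurableSet_cube n R) Ψ ∧
      ∀ ρ : K, ‖G ρ - restriction T (Ψ ρ)‖ ≤ ε := by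
  obtain ⟨R, hR, ι, _, φ, hφ, c, hφc, hφ0, hc, hGc⟩ :=
    exists_finite_rank_approx hT hK hG (half_pos hε)
  refine ⟨R, hR, ?_⟩
  have hΩ : MeasurableSet (cube n R) := measurableSet_cube n R
  -- The closed cube supplies the compactness; the operator itself lives on the open one.
  let X : Set (Fin n → ℝ) := Set.Icc (fun _ => -R) (fun _ => R)
  let H : C((restriction (cube n R) '' K : Set (L1On (cube n R))) × X, ℝ) :=
    ⟨fun q => ∑ j, c j q.1 * φ j q.2, continuous_finsetSum _ fun j _ =>
      Continuous.mul
        (f := fun q : (restriction (cube n R) '' K : Set (L1On (cube n R))) × X => c j q.1)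
        ((continuousOn_iff_continuous_domRestrict.1 (hc j)).comp continuous_fst)
        ((hφc j).comp (continuous_subtype_val.comp continuous_snd))⟩
  set v : ℝ := ((volume : Measure (Fin n → ℝ)).restrict (cube n R)).real Set.univ with hv
  have hv0 : 0 ≤ v := measureReal_nonneg
  -- A uniform error of this size costs at most `ε / 2` in L¹ over a cube of volume `v`. Outside the
  -- cube both the `φ j` and the zero extension vanish, so no error arises there.
  have ha : 0 < ε / 2 / (v + 1) := by positivity
  obtain ⟨p, d, w, b, ψ, hψ, hH⟩ := exists_functionalNet_approx hσ hna
    (hK.image (continuous_restriction hΩ)) (isCompact_Icc (a := fun _ : Fin n => -R)) H ha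
  obtain ⟨Ψ, hΨ, hΨe⟩ := exists_isFullNO_ae_eq hσ.continuous R d w b ψ hψ
  refine ⟨Ψ, hΨ, fun ρ => ?_⟩
  set S : L1On T := ∑ j, c j (restriction (cube n R) ρ) • (hφ j).toLp (φ j) with hS
  have hSe : ∀ᵐ x ∂(volume.restrict T), S x = ∑ j, c j (restriction (cube n R) ρ) * φ j x := by
    have h2 : ∀ᵐ x ∂(volume.restrict T), ∀ j,
        (c j (restriction (cube n R) ρ) • (hφ j).toLp (φ j) : L1On T) x =
          c j (restriction (cube n R) ρ) * φ j x := by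
      refine ae_all_iff.2 fun j => ?_
      filter_upwards [Lp.coeFn_smul (c j (restriction (cube n R) ρ)) ((hφ j).toLp (φ j)),
        (hφ j).coeFn_toLp] with x h3 h4
      rw [h3, Pi.smul_apply, h4, smul_eq_mul]
    filter_upwards [Lp.coeFn_finsetSum Finset.univ fun j =>
      c j (restriction (cube n R) ρ) • (hφ j).toLp (φ j), h2] with x h1 h2
    rw [hS, h1, Finset.sum_apply]
    exact Finset.sum_congr rfl fun j _ => h2 j
  have hnorm : ‖S - restriction T (Ψ ρ)‖ ≤ ε / 2 / (v + 1) * v := by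
    refine norm_sub_le_of_abs_sub_le_indicator hΩ ha.le ?_
    filter_upwards [hSe, restriction_ae_eq T (Ψ ρ), ae_restrict_of_ae (hΨe ρ)] with x h1 h2 h3
    rw [h1, h2, h3]
    by_cases hx : x ∈ cube n R
    · rw [Set.indicator_of_mem hx, Set.indicator_of_mem hx]
      exact hH (⟨_, ρ, ρ.2, rfl⟩, ⟨x, cube_subset_Icc n R hx⟩)
    · rw [Set.indicator_of_notMem hx, Set.indicator_of_notMem hx]
      simp [hφ0 _ x hx]
  have hle : ε / 2 / (v + 1) * v ≤ ε / 2 := by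
    rw [div_mul_eq_mul_div, div_le_iff₀ (by positivity)]
    nlinarith
  calc ‖G ρ - restriction T (Ψ ρ)‖ = ‖(G ρ - S) + (S - restriction T (Ψ ρ))‖ := by
        rw [sub_add_sub_cancel]
    _ ≤ ‖G ρ - S‖ + ‖S - restriction T (Ψ ρ)‖ := norm_add_le _ _
    _ ≤ ε := by linarith [hGc ρ]

end FullSpaceConditioning

theorem mainTheorem4 {m r : ℕ} (σ : ℝ → ℝ) (hσ_lip : ∃ C : NNReal, LipschitzWith C σ)
    (hσ_nonaffine : ¬ ∃ a b : ℝ, ∀ x, σ x = a * x + b)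
    {ε δ : ℝ} (hε : 0 < ε) (hδ : 0 < δ)
    {B : Set (Fin r → ℝ)} (hB_bdd : Bornology.IsBounded B) (hB_open : IsOpen B)
    {K : Set (FullSpaceConditioning.L1 (m + r))}
    (hKU : K ⊆ FullSpaceConditioning.densitiesBoundedBelow m δ B) (hK : IsCompact K) :
    ∃ R : ℝ, 0 < R ∧
      ∃ Ψ : FullSpaceConditioning.L1 (m + r) → FullSpaceConditioning.L1 (m + r),
        FullSpaceConditioning.IsFullNO σ
          (FullSpaceConditioning.measurableSet_cube (m + r) R) Ψ ∧
        ∀ (ρ : FullSpaceConditioning.L1 (m + r)) (hρ : ρ ∈ K),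
          ‖FullSpaceConditioning.kernelConditioning hδ hB_open.measurableSet ⟨ρ, hKU hρ⟩ -
            FullSpaceConditioning.restriction (FullSpaceConditioning.strip m B) (Ψ ρ)‖ ≤ ε := by
  obtain ⟨C, hC⟩ := hσ_lip
  obtain ⟨R, hR, Ψ, hΨ, h⟩ := FullSpaceConditioning.exists_isFullNO_approx hC hσ_nonaffine
    (FullSpaceConditioning.measurable_query hB_open.measurableSet) hK
    ((FullSpaceConditioning.lipschitzWith_kernelConditioning hδ
      hB_open.measurableSet).continuous.comp (continuous_inclusion hKU)) hε
  exact ⟨R, hR, Ψ, hΨ, fun ρ hρ => h ⟨ρ, hρ⟩⟩
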